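/- A *pseudocomplemented distributive lattice* (PDL) is an algebra $\boldsymbol{A}=\langle A;\wedge,\vee,\neg,0,1\rangle$ such that $\langle A;\wedge,\vee,0,1\rangle$ is a bounded distributive lattice and $a\le\neg b\iff a\wedge b=0$ for all $a,b\in A$. The *dual* $\boldsymbol{B}_*$ of a finite PDL $\boldsymbol{B}$ is the poset of prime filters of $\boldsymbol{B}$ ordered by inclusion. For a poset $X$ and $Y\subseteq X$, $\max Y$ denotes the set of maximal elements of the subposet $Y$, and ${\uparrow}x=\{y\in X: x\le y\}$. A poset $X$ has a *free skeleton* if it has a minimum $\bot$ and there are elements $s_{x,Y}\in X$, for $x\in X$ and $\varnothing\neq Y\subseteq\max{\uparrow}x$, such that: (i) $x\le s_{x,Y}$ and $Y=\max{\uparrow}s_{x,Y}$ for all $x\in X$ and $\varnothing\ne Y\subseteq\max{\uparrow}x$; (ii) $Y\subseteq Z$ implies $s_{x,Z}\le s_{x,Y}$ for all $x\in X$ and nonempty $Y,Z\subseteq\max{\uparrow}x$; (iii) $\max{\uparrow}x\subseteq Y$ implies $s_{\bot,Y}\le x$ for all $x\in X$ and $\varnothing\neq Y\subseteq\max X$.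 *Formulas.* Write $\sqcap,\sqcup,\Rightarrow$ for first-order conjunction, disjunction and implication, and let $t\le t'$ stand for $t\wedge t'\approx t$. Empty meets, joins, conjunctions and disjunctions are $1$, $0$, true and false, respectively. Let $\wp(N)$ be the powerset of $\{1,\dots,N\}$. For $\vec u=\langle u_1,\dots,u_N\rangle$ and $T\in\wp(N)$ let $a_T(\vec u)=\bigwedge_{i\in T}u_i\wedge\bigwedge_{i\notin T}\neg u_i$. Let $\mathcal S(N)$ be the set of pairs $\langle L,\mathcal T\rangle$ with $L\in\wp(N)$, $\mathcal T\subseteq\wp(N)$ and $\varnothing\ne L\subseteq\bigcap\mathcal T$ (where $\bigcap\varnothing=\{1,\dots,N\}$), ordered by $\langle L,\mathcal T\rangle\le\langle L',\mathcal T'\rangle\iff L\supseteq L'$ and $\mathcal T\subseteq\mathcal T'$, and let $p_L^{\mathcal T}(\vec u)=\bigwedge_{i\in L}u_i\wedge\neg\neg\bigvee_{T\in\mathcal T}a_T(\vec u)$. For a term $t$ in the variables $\vec u$ let $$\mathsf{At}_{t,N}(\vec u)= t\not\approx0\ \sqcap\bigsqcup_{T\in\wp(N)}t\approx a_T(\vec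 u),$$ $$\mathsf{Jirr}_{t,N}(\vec u)=\bigsqcup_{\langle L,\mathcal T\rangle\in\mathcal S(N)}\Big(t\approx p_L^{\mathcal T}(\vec u)\ \sqcap\ t\not\approx\bigvee\{p_{L'}^{\mathcal T'}(\vec u):\langle L',\mathcal T'\rangle\in\mathcal S(N),\ \langle L',\mathcal T'\rangle<\langle L,\mathcal T\rangle\}\Big).$$ Let $n,m,h\ge1$ with $h\le m$, put $k=2^h-1$, and fix a bijection $f\colon\{1,\dots,k\}\to\wp(h)\setminus\{\varnothing\}$, depending only on $h$. For disjoint tuples of variables $\vec x=\langle x_1,\dots,x_n\rangle$, $\vec y=\langle y_1,\dots,y_m\rangle$ and $\vec z=\langle z_1,\dots,z_k\rangle$ let $$P(\vec x,\vec y)=\bigsqcap_{1\le i<j\le h}y_i\not\approx y_j\ \sqcap\ \bigsqcap_{i=1}^h y_i\le x_1\ \sqcap\bigsqcap_{j=h+1}^m y_j\nleq x_1,$$ $$Q(\vec x,\vec y,\vec z)=\bigsqcap_{i\le k}z_i\le x_1\ \sqcap\bigsqcap_{\substack{i,j\le k\\ f(i)\subseteq f(j)}}z_i\le z_j\ \sqcap\bigsqcap_{\substack{i\le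 k,\ j\le m\\ j\in f(i)}}y_j\le z_i\ \sqcap\bigsqcap_{\substack{i\le k,\ j\le m\\ j\notin f(i)}}y_j\nleq z_i .$$ Let $\mathrm{FS}_{n,m,k}(\vec x,\vec y)$ be the quantifier-free formula $$\Big(\mathsf{Jirr}_{x_1,n+m}(\vec x,\vec y)\sqcap\bigsqcap_{i=1}^m\mathsf{At}_{y_i,n+m}(\vec x,\vec y)\sqcap P(\vec x,\vec y)\Big)\Rightarrow\bigsqcup_{\langle\langle L_1,\mathcal T_1\rangle,\dots,\langle L_k,\mathcal T_k\rangle\rangle\in\mathcal S(n+m)^k}\Big(Q(\vec x,\vec y,p_1,\dots,p_k)\sqcap\bigsqcap_{j=1}^k\mathsf{Jirr}_{p_j,n+m}(\vec x,\vec y)\Big),$$ where $p_j=p_{L_j}^{\mathcal T_j}(\vec x,\vec y)$. Let $\mathrm{DN}(x,y,z)$ be $\neg\neg x\approx y\vee z\Rightarrow(y\approx\neg\neg x\sqcup z\approx\neg\neg x)$. Let $\Sigma$ be the set of universal closures of $0\not\approx1$, $\mathrm{DN}(x,y,z)$, and all $\mathrm{FS}_{n,m,2^h-1}(\vec x,\vec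 y)$ with $n,m,h\ge1$ and $h\le m$. **Proposition.** For every choice of the bijections $f$ and every PDL $\boldsymbol{A}$, one has $\boldsymbol{A}\vDash\Sigma$ if and only if $\boldsymbol{B}_*$ has a free skeleton for every finite subalgebra $\boldsymbol{B}$ of $\boldsymbol{A}$. -/

import Mathlib

/-- A pseudocomplemented distributive lattice: a bounded distributive lattice with a unary
operation `ᶜ` (written `¬` on paper) such that `a ≤ ¬ b ↔ a ∧ b = 0`. -/
class PDLattice (A : Type*) extends DistribLattice A, BoundedOrder A, Compl A where
  le_compl_iff : ∀ a b : A, a ≤ bᶜ ↔ a ⊓ b = ⊥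

namespace PDL

/-! ### Subalgebras -/

/-- A subalgebra: a subset closed under `∧`, `∨`, `¬`, `0`, `1`. -/
structure Subalg (A : Type*) [PDLattice A] extends Sublattice A where
  bot_mem' : ⊥ ∈ carrier
  top_mem' : ⊤ ∈ carrier
  compl_mem' : ∀ {a : A}, a ∈ carrier → aᶜ ∈ carrier

namespace Subalg

instance instSetLike {A : Type*} [PDLattice A] : SetLike (Subalg A) A where
  coe B := B.carrier
  coe_injective B C h := by
    obtain ⟨⟨_, _⟩, _⟩ := B
    obtain ⟨⟨_, _⟩, _⟩ := C
    congr

/-- A subalgebra is a pseudocomplemented distributive lattice with the restricted operations. -/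
instance instPDLattice {A : Type*} [PDLattice A] (B : Subalg A) : PDLattice B where
  toDistribLattice := inferInstanceAs (DistribLattice B.toSublattice)
  top := ⟨⊤, B.top_mem'⟩
  le_top a := (le_top : (a : A) ≤ ⊤)
  bot := ⟨⊥, B.bot_mem'⟩
  bot_le a := (bot_le : ⊥ ≤ (a : A))
  compl a := ⟨(a : A)ᶜ, B.compl_mem' a.2⟩
  le_compl_iff a b := (PDLattice.le_compl_iff (a : A) (b : A)).trans
    ⟨fun h => Subtype.ext h, fun h => congrArg Subtype.val h⟩

end Subalg

/-! ### The dual poset and free skeletons -/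

/-- The poset underlying the Priestley dual: the prime filters, ordered by inclusion.
(For finite `A` the topology of the dual is discrete.) -/
abbrev Dual (A : Type*) [PDLattice A] : Type _ :=
  {F : Order.PFilter A // F.IsPrime}

/-- `max ↑x`, the set of maximal elements of the principal upset of `x`. -/
def maxAbove {X : Type*} [PartialOrder X] (x : X) : Set X :=
  {y | Maximal (fun z => x ≤ z) y}

/-- `max X`, the set of maximal elements of `X`. -/
def maxElts (X : Type*) [PartialOrder X] : Set X := {y | IsMax y}

/-- The poset `X` has a minimum `b` and elements `s x Y`, for `x : X` and nonempty
`Y ⊆ max ↑x`, satisfying the three conditions of a free skeleton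
(the values of `s x Y` for other `Y` are irrelevant). -/
def HasFreeSkeleton (X : Type*) [PartialOrder X] : Prop :=
  ∃ b : X, (∀ x, b ≤ x) ∧ ∃ s : X → Set X → X,
    (∀ (x : X) (Y : Set X), Y.Nonempty → Y ⊆ maxAbove x →
      x ≤ s x Y ∧ Y = maxAbove (s x Y)) ∧
    (∀ (x : X) (Y Z : Set X), Y.Nonempty → Z.Nonempty → Y ⊆ maxAbove x → Z ⊆ maxAbove x →
      Y ⊆ Z → s x Z ≤ s x Y) ∧
    (∀ (x : X) (Y : Set X), Y.Nonempty → Y ⊆ maxElts X →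
      maxAbove x ⊆ Y → s b Y ≤ x)

/-! ### The first-order language of pseudocomplemented distributive lattices -/

/-- The operation symbols `∧, ∨, ¬, 0, 1`. -/
inductive Op : ℕ → Type
  | meet : Op 2
  | join : Op 2
  | neg : Op 1
  | zero : Op 0
  | one : Op 0

/-- The (purely algebraic) language of pseudocomplemented distributive lattices. -/
def lang : FirstOrder.Language.{0, 0} := ⟨Op, fun _ => Empty⟩

instance instStructure (A : Type*) [PDLattice A] : lang.Structure A where
  funMap {_} o := match o with
    | Op.meet => fun v => v 0 ⊓ v 1
    | Op.join => fun v => v 0 ⊔ v 1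
    | Op.neg => fun v => (v 0)ᶜ
    | Op.zero => fun _ => ⊥
    | Op.one => fun _ => ⊤
  RelMap {_} r := Empty.elim r

section Formulas
open FirstOrder FirstOrder.Language

noncomputable section

def tMeet {V : Type} (s t : lang.Term V) : lang.Term V := Functions.apply₂ (L := lang) Op.meet s t
def tJoin {V : Type} (s t : lang.Term V) : lang.Term V := Functions.apply₂ (L := lang) Op.join s t
def tNeg {V : Type} (t : lang.Term V) : lang.Term V := Functions.apply₁ (L := lang) Op.neg t
def tZero {V : Type} : lang.Term V := Term.func (L := lang) (Op.zero : lang.Functions 0) ![]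
def tOne {V : Type} : lang.Term V := Term.func (L := lang) (Op.one : lang.Functions 0) ![]

/-- `⋀_{i ∈ s} t i`, with the empty meet equal to `1`. -/
def bigMeet {V ι : Type} (s : Finset ι) (t : ι → lang.Term V) : lang.Term V :=
  (s.toList.map t).foldr tMeet tOne

/-- `⋁_{i ∈ s} t i`, with the empty join equal to `0`. -/
def bigJoin {V ι : Type} (s : Finset ι) (t : ι → lang.Term V) : lang.Term V :=
  (s.toList.map t).foldr tJoin tZero

/-- The formula `s ≤ t`, i.e. the equation `s ∧ t ≈ s`. -/
def fLe {V : Type} (s t : lang.Term V) : lang.Formula V := Term.equal (tMeet s t) s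

/-! In what follows the tuple of variables is indexed by a finite type `V`, which replaces
`{1, …, n}`; its entries are the variables `Term.var i`. -/

open Classical in
/-- `a_T = ⋀_{i ∈ T} x_i ∧ ⋀_{i ∉ T} ¬ x_i`. -/
def aTerm {V : Type} [Fintype V] (T : Finset V) : lang.Term V :=
  tMeet (bigMeet T Term.var) (bigMeet Tᶜ fun i => tNeg (Term.var i))

/-- `𝓢(V)`: the pairs `⟨L, 𝓣⟩` with `∅ ≠ L ⊆ ⋂ 𝓣`. -/
def IsS {V : Type} (p : Finset V × Finset (Finset V)) : Prop :=
  p.1.Nonempty ∧ ∀ T ∈ p.2, p.1 ⊆ T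

/-- `⟨L, 𝓣⟩ ≤ ⟨L', 𝓣'⟩ ↔ L ⊇ L'` and `𝓣 ⊆ 𝓣'`. -/
def sLe {V : Type} (p q : Finset V × Finset (Finset V)) : Prop :=
  q.1 ⊆ p.1 ∧ p.2 ⊆ q.2

/-- `p_L^𝓣 = ⋀_{i ∈ L} x_i ∧ ¬¬ ⋁_{T ∈ 𝓣} a_T`. -/
def pTerm {V : Type} [Fintype V] (p : Finset V × Finset (Finset V)) : lang.Term V :=
  tMeet (bigMeet p.1 Term.var) (tNeg (tNeg (bigJoin p.2 aTerm)))

/-- `At_t = t ≉ 0 ⊓ ⨆_T t ≈ a_T`. -/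
def atFormula {V : Type} [Fintype V] (t : lang.Term V) : lang.Formula V :=
  ∼(Term.equal t tZero) ⊓ Formula.iSup fun T : Finset V => Term.equal t (aTerm T)

open Classical in
/-- `Jirr_t`: the disjunction over `⟨L, 𝓣⟩ ∈ 𝓢(V)` of
`t ≈ p_L^𝓣 ⊓ t ≉ ⋁ {p_{L'}^{𝓣'} : ⟨L', 𝓣'⟩ ∈ 𝓢(V), ⟨L', 𝓣'⟩ < ⟨L, 𝓣⟩}`. -/
def jirrFormula {V : Type} [Fintype V] (t : lang.Term V) : lang.Formula V :=
  Formula.iSup fun p : {p : Finset V × Finset (Finset V) // IsS p} =>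
    Term.equal t (pTerm p.1) ⊓
      ∼(Term.equal t (bigJoin
        (Finset.univ.filter fun q : Finset V × Finset (Finset V) =>
          IsS q ∧ sLe q p.1 ∧ q ≠ p.1) pTerm))

/-- The formula `F_{n,m,k}` attached to `P(x, y)` and `Q(x, y, z)`. The variables `x_1, …, x_n` are
`Sum.inl _`, the variables `y_1, …, y_m` are `Sum.inr _`; in `Q` these are injected by another
`Sum.inl`, and the variables `z_1, …, z_k` are `Sum.inr _`. -/
def F {n m k : ℕ} (hn : 0 < n) (P : lang.Formula (Fin n ⊕ Fin m))
    (Q : lang.Formula ((Fin n ⊕ Fin m) ⊕ Fin k)) : lang.Formula (Fin n ⊕ Fin m) :=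
  (jirrFormula (Term.var (Sum.inl ⟨0, hn⟩)) ⊓
      Formula.iInf (fun i : Fin m => atFormula (Term.var (Sum.inr i))) ⊓ P).imp
    (Formula.iSup fun S : Fin k →
        {p : Finset (Fin n ⊕ Fin m) × Finset (Finset (Fin n ⊕ Fin m)) // IsS p} =>
      BoundedFormula.subst Q (Sum.elim Term.var fun j => pTerm (S j).1) ⊓
        Formula.iInf fun j : Fin k => jirrFormula (pTerm (S j).1))

/-- `P_{n,m,h}`: `y_1, …, y_h` are pairwise distinct and `≤ x_1`, and
`y_{h+1}, …, y_m` are `≰ x_1`. -/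
def PFormula {n : ℕ} (m h : ℕ) (hn : 0 < n) : lang.Formula (Fin n ⊕ Fin m) :=
  (Formula.iInf fun p : {p : Fin m × Fin m // p.1 < p.2 ∧ (p.2 : ℕ) < h} =>
      ∼(Term.equal (Term.var (Sum.inr p.1.1)) (Term.var (Sum.inr p.1.2)))) ⊓
  (Formula.iInf fun i : {i : Fin m // (i : ℕ) < h} =>
      fLe (Term.var (Sum.inr i.1)) (Term.var (Sum.inl ⟨0, hn⟩))) ⊓
  (Formula.iInf fun j : {j : Fin m // h ≤ (j : ℕ)} =>
      ∼(fLe (Term.var (Sum.inr j.1)) (Term.var (Sum.inl ⟨0, hn⟩))))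

/-- Bijections from a set with `2^h - 1` elements to the nonempty subsets of `{0, …, h - 1}`. -/
abbrev Enum (h : ℕ) : Type :=
  Fin (2 ^ h - 1) ≃ {s : Finset ℕ // s ⊆ Finset.range h ∧ s.Nonempty}

/-- `Q_{n,m,h}`, for the bijection `f` (indices start at `0`). -/
def QFormula {n : ℕ} (m h : ℕ) (hn : 0 < n) (f : Enum h) :
    lang.Formula ((Fin n ⊕ Fin m) ⊕ Fin (2 ^ h - 1)) :=
  (Formula.iInf fun i : Fin (2 ^ h - 1) =>
      fLe (Term.var (Sum.inr i)) (Term.var (Sum.inl (Sum.inl ⟨0, hn⟩)))) ⊓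
  (Formula.iInf fun p : {p : Fin (2 ^ h - 1) × Fin (2 ^ h - 1) // (f p.1).1 ⊆ (f p.2).1} =>
      fLe (Term.var (Sum.inr p.1.1)) (Term.var (Sum.inr p.1.2))) ⊓
  (Formula.iInf fun p : {p : Fin (2 ^ h - 1) × Fin m // (p.2 : ℕ) ∈ (f p.1).1} =>
      fLe (Term.var (Sum.inl (Sum.inr p.1.2))) (Term.var (Sum.inr p.1.1))) ⊓
  (Formula.iInf fun p : {p : Fin (2 ^ h - 1) × Fin m // (p.2 : ℕ) ∉ (f p.1).1} =>
      ∼(fLe (Term.var (Sum.inl (Sum.inr p.1.2))) (Term.var (Sum.inr p.1.1))))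

/-- `FS_{n,m,2^h-1}`. -/
def FS {n : ℕ} (m h : ℕ) (hn : 0 < n) (f : Enum h) : lang.Formula (Fin n ⊕ Fin m) :=
  F hn (PFormula m h hn) (QFormula m h hn f)

/-- `DN(x, y, z)`: `¬¬x ≈ y ∨ z ⇒ (y ≈ ¬¬x ⊔ z ≈ ¬¬x)`, with `x, y, z` the variables `0, 1, 2`. -/
def DN : lang.Formula (Fin 3) :=
  (Term.equal (tNeg (tNeg (Term.var 0))) (tJoin (Term.var 1) (Term.var 2))).imp
    (Term.equal (Term.var 1) (tNeg (tNeg (Term.var 0))) ⊔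
      Term.equal (Term.var 2) (tNeg (tNeg (Term.var 0))))

/-- `0 ≉ 1`. -/
def zeroNeOne : lang.Sentence := ∼(Term.equal tZero tOne)

/-- The universal closure of a formula in finitely many free variables. -/
def univClosure {V : Type} [Finite V] (φ : lang.Formula V) : lang.Sentence :=
  Formula.iAlls V (Formula.relabel (Sum.inr : V → Empty ⊕ V) φ)

/-- The set of axioms `Σ`, for a fixed choice `f` of the bijections used in the `FS` formulas. -/
def Axioms (f : ∀ h : ℕ, Enum h) : lang.Theory :=
  {zeroNeOne, univClosure DN} ∪
    {σ | ∃ (n m h : ℕ) (hn : 0 < n), 0 < h ∧ h ≤ m ∧ σ = univClosure (FS m h hn (f h))}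

end

end Formulas

end PDL

namespace PDL

/-! ### Normal forms in finitely generated pseudocomplemented distributive lattices. -/

section Elements

variable {A : Type*} [PDLattice A]

/-! Local finiteness makes order-theoretic notions expressible by terms. The subalgebra generated by
a finite tuple `v` consists of the finite joins of the elements `pE v q` (`genSubalg`), so it is
finite. Inside it, `IsAt` means being an atom and `IsJirr` means being a sup-prime element below
some entry of the tuple (`Generates.isAt_iff`, `Generates.isJirr_iff`).

For finite `B`, prime filters correspond to sup-prime elements with the order reversed, and maximal
prime filters to atoms. Conditions (i) and (ii) of a free skeleton at one point `x` then become
`LocalSkeleton x`, a monotone choice of sup-prime elements below `x` with prescribed atoms; this is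
what the `FS` formulas assert. Condition (iii) concerns only the minimum, that is, the top element
of `B`: it forces the choice for a set `Y` of atoms to be `¬¬⋁Y`, the largest element with all its
atoms in `Y`. So it amounts to nonzero regular elements (those of the form `¬¬r`) being sup-prime,
which is `DN`; together with `0 ≠ 1` it also gives the minimum.

The axioms are universal, so they pass to subalgebras; conversely, each instance can be checked in
the finite subalgebra generated by the values of its variables. -/

theorem inf_compl_eq_bot (a : A) : a ⊓ aᶜ = ⊥ := by
  rw [inf_comm]; exact (PDLattice.le_compl_iff _ _).1 le_rfl

theorem le_compl_compl_self (a : A) : a ≤ aᶜᶜ :=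
  (PDLattice.le_compl_iff _ _).2 (inf_compl_eq_bot a)

theorem compl_le_compl_of_le {a b : A} (h : a ≤ b) : bᶜ ≤ aᶜ :=
  (PDLattice.le_compl_iff _ _).2 (le_bot_iff.1
    ((inf_le_inf_left _ h).trans (by rw [inf_comm, inf_compl_eq_bot])))

theorem compl_compl_compl_eq (a : A) : aᶜᶜᶜ = aᶜ :=
  le_antisymm (compl_le_compl_of_le (le_compl_compl_self a)) (le_compl_compl_self _)

theorem bot_compl_eq : (⊥ : A)ᶜ = ⊤ :=
  top_le_iff.1 ((PDLattice.le_compl_iff _ _).2 (inf_bot_eq _))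

theorem top_compl_eq : (⊤ : A)ᶜ = ⊥ := by
  simpa using inf_compl_eq_bot (⊤ : A)

theorem inf_eq_bot_mono {a b c d : A} (h : a ⊓ b = ⊥) (hc : c ≤ a) (hd : d ≤ b) : c ⊓ d = ⊥ :=
  le_bot_iff.1 (h ▸ inf_le_inf hc hd)

variable {V : Type}

/-- Substitute for excluded middle: a nonzero element either meets `v i`, and can be replaced by
that meet, or already lies below the pseudocomplement of `v i`. -/
theorem exists_le_decided (v : V → A) (S : Finset V) {c : A} (hc : c ≠ ⊥) :
    ∃ d ≤ c, d ≠ ⊥ ∧ ∀ i ∈ S, d ≤ v i ∨ d ≤ (v i)ᶜ := by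
  classical
  induction S using Finset.induction_on with
  | empty => exact ⟨c, le_rfl, hc, by simp⟩
  | insert i S _ ih =>
    obtain ⟨d, hdc, hd, hS⟩ := ih
    by_cases h : d ⊓ v i = ⊥
    · refine ⟨d, hdc, hd, fun j hj => ?_⟩
      rcases Finset.mem_insert.1 hj with rfl | hj
      · exact .inr ((PDLattice.le_compl_iff _ _).2 h)
      · exact hS j hj
    · refine ⟨d ⊓ v i, inf_le_left.trans hdc, h, fun j hj => ?_⟩
      rcases Finset.mem_insert.1 hj with rfl | hj
      · exact .inl inf_le_right
      · exact (hS j hj).imp inf_le_left.trans inf_le_left.trans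

open Classical in
/-- The index of the meet of two values of `pE`. -/
noncomputable def sInf (q q' : Finset V × Finset (Finset V)) : Finset V × Finset (Finset V) :=
  (q.1 ∪ q'.1, (q.2 ∩ q'.2).filter (q.1 ∪ q'.1 ⊆ ·))

open Classical in
theorem isS_sInf {q q' : Finset V × Finset (Finset V)} (h : (q.1 ∪ q'.1).Nonempty) :
    IsS (sInf q q') := by
  refine ⟨h, fun T hT => ?_⟩
  exact (Finset.mem_filter.1 hT).2

theorem sInf_sLe (q q' : Finset V × Finset (Finset V)) : sLe (sInf q q') q := by
  classical
  exact ⟨Finset.subset_union_left, fun T hT =>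
    (Finset.mem_inter.1 (Finset.mem_filter.1 hT).1).1⟩

/-! ### The elements `aE`, `pE` and the generated subalgebra. -/

variable [Fintype V]

open Classical in
/-- The value of `aTerm T`. -/
noncomputable def aE (v : V → A) (T : Finset V) : A :=
  T.inf v ⊓ Tᶜ.inf fun i => (v i)ᶜ

/-- The value of `pTerm q`. -/
noncomputable def pE (v : V → A) (q : Finset V × Finset (Finset V)) : A :=
  q.1.inf v ⊓ (q.2.sup (aE v))ᶜᶜ

theorem le_aE_iff (v : V → A) (T : Finset V) (c : A) :
    c ≤ aE v T ↔ (∀ i ∈ T, c ≤ v i) ∧ ∀ i ∉ T, c ≤ (v i)ᶜ := by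
  simp [aE, Finset.le_inf_iff]

theorem aE_le {v : V → A} {T : Finset V} {i : V} (h : i ∈ T) : aE v T ≤ v i :=
  ((le_aE_iff v T _).1 le_rfl).1 i h

theorem aE_le_compl {v : V → A} {T : Finset V} {i : V} (h : i ∉ T) : aE v T ≤ (v i)ᶜ :=
  ((le_aE_iff v T _).1 le_rfl).2 i h

theorem inf_aE_eq_bot_of_le {v : V → A} {T : Finset V} {i : V} (h : i ∉ T) {c : A}
    (hc : c ≤ v i) : c ⊓ aE v T = ⊥ :=
  inf_eq_bot_mono (inf_compl_eq_bot (v i)) hc (aE_le_compl h)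

theorem aE_inf_aE {v : V → A} {S T : Finset V} (h : S ≠ T) : aE v S ⊓ aE v T = ⊥ := by
  have : ∃ i, ¬ (i ∈ S ↔ i ∈ T) := by
    by_contra! hh
    exact h (Finset.ext hh)
  obtain ⟨i, hi⟩ := this
  by_cases hS : i ∈ S
  · exact inf_aE_eq_bot_of_le (fun hT => hi ⟨fun _ => hT, fun _ => hS⟩) (aE_le hS)
  · have hT : i ∈ T := by by_contra hT; exact hi ⟨fun h => (hS h).elim, fun h => (hT h).elim⟩
    rw [inf_comm]
    exact inf_aE_eq_bot_of_le hS (aE_le hT)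

/-- The join of all `aE v T` is dense: a nonzero `c` shrinks to some `d ≠ ⊥` deciding every `v i`,
and `d ≤ aE v T` for `T = {i | d ≤ v i}`. -/
theorem eq_bot_of_inf_aE {v : V → A} {c : A} (h : ∀ T, c ⊓ aE v T = ⊥) : c = ⊥ := by
  classical
  by_contra hc
  obtain ⟨d, hdc, hd, hS⟩ := exists_le_decided v Finset.univ hc
  refine hd (le_bot_iff.1 ?_)
  rw [← h (Finset.univ.filter fun i => d ≤ v i)]
  refine le_inf hdc ((le_aE_iff _ _ _).2 ⟨fun i hi => by simpa using hi, fun i hi => ?_⟩)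
  exact (hS i (Finset.mem_univ i)).resolve_left (by simpa using hi)

/-- As the `aE v T` are pairwise disjoint with dense join, being below the double complement means
avoiding the remaining ones. This reduces identities between the `pE` to combinatorics. -/
theorem le_sup_aE_compl_compl_iff (v : V → A) (𝒯 : Finset (Finset V)) (c : A) :
    c ≤ (𝒯.sup (aE v))ᶜᶜ ↔ ∀ T ∉ 𝒯, c ⊓ aE v T = ⊥ := by
  constructor
  · intro h T hT
    refine inf_eq_bot_mono (inf_compl_eq_bot ((𝒯.sup (aE v))ᶜᶜ)) h ?_
    rw [compl_compl_compl_eq, PDLattice.le_compl_iff, Finset.sup_inf_distrib_left]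
    refine (Finset.sup_eq_bot_iff _ _).2 fun S hS => aE_inf_aE ?_
    rintro rfl
    exact hT hS
  · intro h
    rw [PDLattice.le_compl_iff]
    refine eq_bot_of_inf_aE (v := v) fun T => ?_
    by_cases hT : T ∈ 𝒯
    · rw [inf_comm]
      exact inf_eq_bot_mono (inf_compl_eq_bot (𝒯.sup (aE v)))
        (Finset.le_sup (f := aE v) hT) inf_le_right
    · exact inf_eq_bot_mono (h T hT) inf_le_left le_rfl

theorem le_pE_iff (v : V → A) (q : Finset V × Finset (Finset V)) (c : A) :
    c ≤ pE v q ↔ (∀ i ∈ q.1, c ≤ v i) ∧ ∀ T ∉ q.2, c ⊓ aE v T = ⊥ := by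
  rw [pE, le_inf_iff, Finset.le_inf_iff, le_sup_aE_compl_compl_iff]

theorem pE_mono (v : V → A) {q q' : Finset V × Finset (Finset V)} (h : sLe q q') :
    pE v q ≤ pE v q' := by
  obtain ⟨h₁, h₂⟩ := (le_pE_iff v q _).1 le_rfl
  exact (le_pE_iff v q' _).2 ⟨fun i hi => h₁ i (h.1 hi), fun T hT => h₂ T fun hh => hT (h.2 hh)⟩

theorem pE_sInf (v : V → A) (q q' : Finset V × Finset (Finset V)) :
    pE v (sInf q q') = pE v q ⊓ pE v q' := by
  classical
  refine eq_of_forall_le_iff fun c => ?_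
  rw [le_inf_iff, le_pE_iff, le_pE_iff, le_pE_iff]
  simp only [sInf, Finset.mem_union, Finset.mem_filter, Finset.mem_inter]
  constructor
  · rintro ⟨h₁, h₂⟩
    exact ⟨⟨fun i hi => h₁ i (.inl hi), fun T hT => h₂ T fun h => hT h.1.1⟩,
      fun i hi => h₁ i (.inr hi), fun T hT => h₂ T fun h => hT h.1.2⟩
  · rintro ⟨⟨h₁, h₂⟩, h₃, h₄⟩
    have h₅ : ∀ i ∈ q.1 ∪ q'.1, c ≤ v i := fun i hi =>
      (Finset.mem_union.1 hi).elim (h₁ i) (h₃ i)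
    refine ⟨fun i hi => h₅ i (Finset.mem_union.2 hi), fun T hT => ?_⟩
    by_cases hq : T ∈ q.2
    · by_cases hq' : T ∈ q'.2
      -- A `T` discarded by the filter in `sInf` omits some index `i` with `c ≤ v i`, so `c` is
      -- disjoint from `aE v T` anyway.
      · obtain ⟨i, hi, hiT⟩ := Finset.not_subset.1 fun h => hT ⟨⟨hq, hq'⟩, h⟩
        exact inf_aE_eq_bot_of_le hiT (h₅ i hi)
      · exact h₄ T hq'
    · exact h₂ T hq

theorem pE_singleton_univ (v : V → A) (i : V) : pE v ({i}, Finset.univ) = v i :=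
  eq_of_forall_le_iff fun c => by rw [le_pE_iff]; simp

theorem pE_empty_univ (v : V → A) : pE v (∅, Finset.univ) = ⊤ :=
  eq_of_forall_le_iff fun c => by rw [le_pE_iff]; simp

/-- Either `L ⊆ T` and `T ∈ 𝒯`, so that `aE v T` lies below the corresponding `pE`, or the two are
disjoint. Hence a nonzero `aE v T` is an atom of the generated subalgebra. -/
theorem aE_le_or_inf_eq_bot_of_sup_pE (v : V → A) (T : Finset V)
    (𝒢 : Finset (Finset V × Finset (Finset V))) :
    aE v T ≤ 𝒢.sup (pE v) ∨ 𝒢.sup (pE v) ⊓ aE v T = ⊥ := by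
  by_cases h : ∃ q ∈ 𝒢, aE v T ≤ pE v q
  · obtain ⟨q, hq, h⟩ := h
    exact .inl (h.trans (Finset.le_sup (f := pE v) hq))
  · push Not at h
    refine .inr ?_
    rw [Finset.sup_inf_distrib_right]
    refine (Finset.sup_eq_bot_iff _ _).2 fun q hq => ?_
    have h₀ := h q hq
    obtain ⟨h₁, h₂⟩ := (le_pE_iff v q _).1 le_rfl
    by_contra hne
    refine h₀ ((le_pE_iff v q _).2 ⟨fun i hi => ?_, fun S hS => ?_⟩)
    · refine aE_le (by_contra fun hiT => hne (inf_aE_eq_bot_of_le hiT (h₁ i hi)))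
    · refine aE_inf_aE ?_
      rintro rfl
      exact hne (h₂ _ hS)

-- By density of the `aE`, a pseudocomplement is determined by the `aE v T` it avoids. The result
-- has `L = ∅`, so the normal form must range over all pairs, not only those in `IsS`.
open Classical in
theorem compl_sup_pE (v : V → A) (𝒢 : Finset (Finset V × Finset (Finset V))) :
    (𝒢.sup (pE v))ᶜ =
      pE v (∅, Finset.univ.filter fun T => 𝒢.sup (pE v) ⊓ aE v T = ⊥) := by
  refine eq_of_forall_le_iff fun c => ?_
  rw [le_pE_iff, PDLattice.le_compl_iff]
  simp only [Finset.notMem_empty, false_implies, implies_true, true_and, Finset.mem_filter,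
    Finset.mem_univ]
  constructor
  · intro h T hT
    exact inf_eq_bot_mono h le_rfl ((aE_le_or_inf_eq_bot_of_sup_pE v T 𝒢).resolve_right hT)
  · intro h
    refine eq_bot_of_inf_aE (v := v) fun T => ?_
    by_cases hT : 𝒢.sup (pE v) ⊓ aE v T = ⊥
    · exact inf_eq_bot_mono hT inf_le_right le_rfl
    · exact inf_eq_bot_mono (h T hT) inf_le_left le_rfl

/-- The subalgebra generated by a finite tuple. -/
noncomputable def genSubalg (v : V → A) : Subalg A where
  carrier := Set.range fun 𝒢 : Finset (Finset V × Finset (Finset V)) => 𝒢.sup (pE v)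
  supClosed' := by
    classical
    rintro _ ⟨𝒢, rfl⟩ _ ⟨ℋ, rfl⟩
    exact ⟨𝒢 ∪ ℋ, Finset.sup_union⟩
  infClosed' := by
    classical
    rintro _ ⟨𝒢, rfl⟩ _ ⟨ℋ, rfl⟩
    refine ⟨(𝒢 ×ˢ ℋ).image fun q => sInf q.1 q.2, ?_⟩
    simp only [Finset.sup_image, Finset.sup_inf_sup]
    exact Finset.sup_congr rfl fun q _ => pE_sInf v q.1 q.2
  bot_mem' := ⟨∅, rfl⟩
  top_mem' := ⟨{(∅, Finset.univ)}, by simp [pE_empty_univ]⟩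
  compl_mem' := by
    rintro _ ⟨𝒢, rfl⟩
    exact ⟨{_}, Finset.sup_singleton.trans (compl_sup_pE v 𝒢).symm⟩

theorem finite_genSubalg (v : V → A) : Finite (genSubalg v) :=
  Set.finite_range fun 𝒢 : Finset (Finset V × Finset (Finset V)) => 𝒢.sup (pE v)

theorem mem_genSubalg (v : V → A) (i : V) : v i ∈ genSubalg v :=
  ⟨{({i}, Finset.univ)}, by simp [pE_singleton_univ]⟩

/-- A tuple generates if every element is a join of values of `pE`. -/
def Generates (v : V → A) : Prop :=
  ∀ b : A, ∃ 𝒢 : Finset (Finset V × Finset (Finset V)), b = 𝒢.sup (pE v)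

theorem generates_of_surjective {v : V → A} (h : Function.Surjective v) : Generates v := by
  intro b
  obtain ⟨i, rfl⟩ := h b
  exact ⟨{({i}, Finset.univ)}, by simp [pE_singleton_univ]⟩

/-- The meaning of `atFormula`. -/
def IsAt (v : V → A) (t : A) : Prop := t ≠ ⊥ ∧ ∃ T, t = aE v T

open Classical in
/-- The meaning of `jirrFormula`. -/
def IsJirr (v : V → A) (t : A) : Prop :=
  ∃ p : {p : Finset V × Finset (Finset V) // IsS p}, t = pE v p.1 ∧
    t ≠ (Finset.univ.filter fun q : Finset V × Finset (Finset V) =>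
      IsS q ∧ sLe q p.1 ∧ q ≠ p.1).sup (pE v)

theorem Generates.isAt_iff {v : V → A} (hv : Generates v) (t : A) : IsAt v t ↔ IsAtom t := by
  classical
  have key : ∀ T b, aE v T ≤ b ∨ b ⊓ aE v T = ⊥ := fun T b => by
    obtain ⟨𝒢, rfl⟩ := hv b
    exact aE_le_or_inf_eq_bot_of_sup_pE v T 𝒢
  constructor
  · rintro ⟨h, T, rfl⟩
    refine ⟨h, fun b hb => ?_⟩
    rcases key T b with h' | h'
    · exact absurd h' hb.not_ge
    · rwa [inf_eq_left.2 hb.le] at h'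
  · intro h
    refine ⟨h.1, ?_⟩
    by_contra! hT
    refine h.1 (eq_bot_of_inf_aE (v := v) fun T => ?_)
    rcases key T t with h' | h'
    · rcases h.le_iff.1 h' with h'' | h''
      · simp [h'']
      · exact absurd h''.symm (hT T)
    · exact h'

/-- The bound by some `v i` reflects `L ≠ ∅` in `IsS`. If `t = pE v p` is below a join,
distributivity splits it into values at pairs `sInf p q`; these cannot all be strictly below `p`,
and `sInf p q = p` gives `t ≤ pE v q`. Conversely, a minimal pair representing a sup-prime `t`
cannot be replaced by smaller ones. -/
theorem Generates.isJirr_iff {v : V → A} (hv : Generates v) (t : A) :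
    IsJirr v t ↔ SupPrime t ∧ ∃ i, t ≤ v i := by
  classical
  constructor
  · rintro ⟨⟨p, hp⟩, rfl, hne⟩
    simp only at hne ⊢
    have hle : (Finset.univ.filter fun q : Finset V × Finset (Finset V) =>
        IsS q ∧ sLe q p ∧ q ≠ p).sup (pE v) ≤ pE v p :=
      Finset.sup_le fun q hq => pE_mono v (Finset.mem_filter.1 hq).2.2.1
    refine ⟨⟨fun hmin => hne ?_, fun b c hbc => ?_⟩, ?_⟩
    · rw [isMin_iff_eq_bot.1 hmin] at hle ⊢
      exact (le_bot_iff.1 hle).symm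
    · obtain ⟨𝒢, rfl⟩ := hv b
      obtain ⟨ℋ, rfl⟩ := hv c
      by_contra! hcon
      refine hne (le_antisymm ?_ hle)
      rw [← Finset.sup_union, ← inf_eq_left, Finset.sup_inf_distrib_left] at hbc
      conv_lhs => rw [← hbc]
      refine Finset.sup_le fun q hq => ?_
      rw [← pE_sInf]
      refine Finset.le_sup (f := pE v) (Finset.mem_filter.2 ⟨Finset.mem_univ _, isS_sInf
        (hp.1.mono Finset.subset_union_left), sInf_sLe _ _, fun heq => ?_⟩)
      have hq' : pE v p ≤ pE v q := by
        rw [← inf_eq_left, ← pE_sInf, heq]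
      rcases Finset.mem_union.1 hq with hq | hq
      · exact hcon.1 (hq'.trans (Finset.le_sup (f := pE v) hq))
      · exact hcon.2 (hq'.trans (Finset.le_sup (f := pE v) hq))
    · obtain ⟨i, hi⟩ := hp.1
      exact ⟨i, ((le_pE_iff v p _).1 le_rfl).1 i hi⟩
  · rintro ⟨ht, i, hi⟩
    have hex : ∃ q : Finset V × Finset (Finset V), IsS q ∧ pE v q = t := by
      obtain ⟨𝒢, h𝒢⟩ := hv t
      obtain ⟨q, hq, hqt⟩ := ht.le_finset_sup.1 h𝒢.le
      -- Meeting with `v i ≥ t` makes `L` nonempty without changing the value.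
      refine ⟨sInf q ({i}, Finset.univ), isS_sInf ⟨i, by simp⟩, ?_⟩
      have : pE v q = t := le_antisymm (h𝒢 ▸ Finset.le_sup (f := pE v) hq) hqt
      rw [pE_sInf, pE_singleton_univ, this, inf_eq_left.2 hi]
    obtain ⟨p, hp, hmin⟩ := Finset.exists_min_image
      (Finset.univ.filter fun q : Finset V × Finset (Finset V) => IsS q ∧ pE v q = t)
      -- This rank strictly increases along `sLe`, since `sLe` reverses inclusion on `L`.
      (fun q => q.1ᶜ.card + q.2.card) (by
        obtain ⟨q, hq⟩ := hex
        exact ⟨q, by simpa using hq⟩)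
    obtain ⟨-, hpS, rfl⟩ := Finset.mem_filter.1 hp
    refine ⟨⟨p, hpS⟩, rfl, fun heq => ?_⟩
    obtain ⟨q, hq, hpq⟩ := ht.le_finset_sup.1 heq.le
    obtain ⟨-, hqS, hqp, hne⟩ := Finset.mem_filter.1 hq
    change sLe q p at hqp
    change q ≠ p at hne
    have h := hmin q (Finset.mem_filter.2 ⟨Finset.mem_univ _, hqS,
      le_antisymm (pE_mono v hqp) hpq⟩)
    have h₁ : q.1ᶜ ⊆ p.1ᶜ := Finset.compl_subset_compl.2 hqp.1
    have c₁ := Finset.card_le_card h₁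
    have c₂ := Finset.card_le_card hqp.2
    refine hne (Prod.ext ?_ (Finset.eq_of_subset_of_card_le hqp.2 (by omega)))
    exact compl_injective (Finset.eq_of_subset_of_card_le h₁ (by omega))

end Elements

end PDL

namespace PDL

/-! ### Realization of the formulas in an algebra. -/

section Semantics

open FirstOrder FirstOrder.Language

variable {A : Type*} [PDLattice A] {V : Type}

theorem realize_tMeet (s t : lang.Term V) (v : V → A) :
    (tMeet s t).realize v = s.realize v ⊓ t.realize v := rfl

theorem realize_tJoin (s t : lang.Term V) (v : V → A) :
    (tJoin s t).realize v = s.realize v ⊔ t.realize v := rfl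

theorem realize_tNeg (t : lang.Term V) (v : V → A) : (tNeg t).realize v = (t.realize v)ᶜ := rfl

theorem realize_tZero (v : V → A) : (tZero : lang.Term V).realize v = ⊥ := rfl

theorem realize_tOne (v : V → A) : (tOne : lang.Term V).realize v = ⊤ := rfl

theorem realize_bigMeet {ι : Type} (s : Finset ι) (t : ι → lang.Term V) (v : V → A) :
    (bigMeet s t).realize v = s.inf fun i => (t i).realize v := by
  have key : ∀ (l : List ι) (c : A),
      c ≤ ((l.map t).foldr tMeet tOne).realize v ↔ ∀ i ∈ l, c ≤ (t i).realize v := by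
    intro l c
    induction l with
    | nil => simp [realize_tOne]
    | cons i l ih => simp [realize_tMeet, ih]
  exact eq_of_forall_le_iff fun c => by rw [bigMeet, key, Finset.le_inf_iff]; simp

theorem realize_bigJoin {ι : Type} (s : Finset ι) (t : ι → lang.Term V) (v : V → A) :
    (bigJoin s t).realize v = s.sup fun i => (t i).realize v := by
  have key : ∀ (l : List ι) (c : A),
      ((l.map t).foldr tJoin tZero).realize v ≤ c ↔ ∀ i ∈ l, (t i).realize v ≤ c := by
    intro l c
    induction l with
    | nil => simp [realize_tZero]
    | cons i l ih => simp [realize_tJoin, ih]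
  exact eq_of_forall_ge_iff fun c => by rw [bigJoin, key, Finset.sup_le_iff]; simp

theorem realize_fLe (s t : lang.Term V) (v : V → A) :
    (fLe s t).Realize v ↔ s.realize v ≤ t.realize v := by
  rw [fLe, Formula.realize_equal, realize_tMeet, inf_eq_left]

variable [Fintype V]

theorem realize_aTerm (T : Finset V) (v : V → A) : (aTerm T).realize v = aE v T := by
  classical
  rw [aTerm, realize_tMeet, realize_bigMeet, realize_bigMeet]
  rfl

theorem realize_pTerm (q : Finset V × Finset (Finset V)) (v : V → A) :
    (pTerm q).realize v = pE v q := by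
  rw [pTerm, realize_tMeet, realize_bigMeet, realize_tNeg, realize_tNeg, realize_bigJoin]
  simp only [realize_aTerm]
  rfl

theorem realize_atFormula (t : lang.Term V) (v : V → A) :
    (atFormula t).Realize v ↔ IsAt v (t.realize v) := by
  simp only [atFormula, Formula.realize_inf, Formula.realize_not, Formula.realize_equal,
    Formula.realize_iSup, realize_aTerm, realize_tZero, IsAt]

theorem realize_jirrFormula (t : lang.Term V) (v : V → A) :
    (jirrFormula t).Realize v ↔ IsJirr v (t.realize v) := by
  simp only [jirrFormula, Formula.realize_inf, Formula.realize_not, Formula.realize_equal,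
    Formula.realize_iSup, realize_pTerm, realize_bigJoin, IsJirr]

/-- The meaning of `PFormula`. -/
def PHolds (h : ℕ) {m : ℕ} (x : A) (y : Fin m → A) : Prop :=
  ((∀ p : {p : Fin m × Fin m // p.1 < p.2 ∧ (p.2 : ℕ) < h}, ¬ y p.1.1 = y p.1.2) ∧
    ∀ i : {i : Fin m // (i : ℕ) < h}, y i.1 ≤ x) ∧ ∀ j : {j : Fin m // h ≤ (j : ℕ)}, ¬ y j.1 ≤ x

/-- The meaning of `QFormula`. -/
def QHolds {h m : ℕ} (f : Enum h) (x : A) (y : Fin m → A) (z : Fin (2 ^ h - 1) → A) : Prop :=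
  (((∀ i, z i ≤ x) ∧
    ∀ p : {p : Fin (2 ^ h - 1) × Fin (2 ^ h - 1) // (f p.1).1 ⊆ (f p.2).1}, z p.1.1 ≤ z p.1.2) ∧
    ∀ p : {p : Fin (2 ^ h - 1) × Fin m // (p.2 : ℕ) ∈ (f p.1).1}, y p.1.2 ≤ z p.1.1) ∧
    ∀ p : {p : Fin (2 ^ h - 1) × Fin m // (p.2 : ℕ) ∉ (f p.1).1}, ¬ y p.1.2 ≤ z p.1.1

/-- The meaning of `FS`. -/
def FSHolds {n m h : ℕ} (hn : 0 < n) (f : Enum h) (v : Fin n ⊕ Fin m → A) : Prop :=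
  (IsJirr v (v (.inl ⟨0, hn⟩)) ∧ ∀ i, IsAt v (v (.inr i))) ∧
      PHolds h (v (.inl ⟨0, hn⟩)) (fun i => v (.inr i)) →
    ∃ S : Fin (2 ^ h - 1) →
        {p : Finset (Fin n ⊕ Fin m) × Finset (Finset (Fin n ⊕ Fin m)) // IsS p},
      QHolds f (v (.inl ⟨0, hn⟩)) (fun i => v (.inr i)) (fun j => pE v (S j).1) ∧
        ∀ j, IsJirr v (pE v (S j).1)

theorem realize_FS {n m h : ℕ} (hn : 0 < n) (f : Enum h) (v : Fin n ⊕ Fin m → A) :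
    (FS m h hn f).Realize v ↔ FSHolds hn f v := by
  have hsub : ∀ (φ : lang.Formula ((Fin n ⊕ Fin m) ⊕ Fin (2 ^ h - 1)))
      (tf : (Fin n ⊕ Fin m) ⊕ Fin (2 ^ h - 1) → lang.Term (Fin n ⊕ Fin m)),
      Formula.Realize (BoundedFormula.subst φ tf) v ↔ φ.Realize fun a => (tf a).realize v :=
    fun φ tf => BoundedFormula.realize_subst
  simp only [FS, F, Formula.realize_imp, Formula.realize_inf, Formula.realize_iInf,
    Formula.realize_iSup, realize_jirrFormula, realize_atFormula, PFormula, QFormula, hsub,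
    Formula.realize_not, Formula.realize_equal, realize_fLe, realize_pTerm, Term.realize_var,
    Sum.elim_inl, Sum.elim_inr, FSHolds, PHolds, QHolds]

/-- The meaning of `DN`. -/
def DNHolds (A : Type*) [PDLattice A] : Prop :=
  ∀ x y z : A, xᶜᶜ = y ⊔ z → y = xᶜᶜ ∨ z = xᶜᶜ

theorem realize_DN (v : Fin 3 → A) :
    DN.Realize v ↔ ((v 0)ᶜᶜ = v 1 ⊔ v 2 → v 1 = (v 0)ᶜᶜ ∨ v 2 = (v 0)ᶜᶜ) := by
  simp only [DN, Formula.realize_imp, Formula.realize_sup, Formula.realize_equal, realize_tNeg,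
    realize_tJoin, Term.realize_var]

theorem realize_univClosure {V : Type} [Finite V] (φ : lang.Formula V) :
    A ⊨ univClosure φ ↔ ∀ v : V → A, φ.Realize v := by
  rw [univClosure, Sentence.Realize, Formula.realize_iAlls]
  simp only [Formula.realize_relabel]
  rfl

theorem model_axioms_iff (f : ∀ h : ℕ, Enum h) :
    A ⊨ Axioms f ↔ (⊥ : A) ≠ ⊤ ∧ DNHolds A ∧
      ∀ (n m h : ℕ) (hn : 0 < n), 0 < h → h ≤ m →
        ∀ v : Fin n ⊕ Fin m → A, FSHolds hn (f h) v := by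
  have h0 : A ⊨ zeroNeOne ↔ (⊥ : A) ≠ ⊤ := by
    rw [zeroNeOne, Sentence.Realize, Formula.realize_not, Formula.realize_equal]
    rfl
  have hDN : A ⊨ univClosure DN ↔ DNHolds A := by
    rw [realize_univClosure]
    simp only [realize_DN]
    exact ⟨fun H x y z => H ![x, y, z], fun H v => H _ _ _⟩
  rw [Theory.model_iff, ← h0, ← hDN]
  constructor
  · intro H
    refine ⟨H _ (.inl (.inl rfl)), H _ (.inl (.inr rfl)), fun n m h hn hh hm v => ?_⟩
    rw [← realize_FS]
    exact (realize_univClosure _).1 (H _ (.inr ⟨n, m, h, hn, hh, hm, rfl⟩)) v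
  · rintro ⟨H₁, H₂, H₃⟩ φ ((rfl | rfl) | ⟨n, m, h, hn, hh, hm, rfl⟩)
    · exact H₁
    · exact H₂
    · exact (realize_univClosure _).2 fun v => (realize_FS hn (f h) v).2 (H₃ n m h hn hh hm v)

end Semantics

/-! ### Absoluteness between a subalgebra and the whole algebra. -/

section Restriction

variable {A : Type*} [PDLattice A] {V : Type} [Fintype V]

theorem Subalg.coe_inj' {B : Subalg A} {a b : B} : (a : A) = b ↔ a = b := Subtype.ext_iff.symm

theorem Subalg.coe_finset_inf {ι : Type*} (B : Subalg A) (s : Finset ι) (g : ι → B) :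
    ((s.inf g : B) : A) = s.inf fun i => (g i : A) := by
  classical
  induction s using Finset.induction_on with
  | empty => rfl
  | insert i s _ ih => rw [Finset.inf_insert, Finset.inf_insert, ← ih]; rfl

theorem Subalg.coe_finset_sup {ι : Type*} (B : Subalg A) (s : Finset ι) (g : ι → B) :
    ((s.sup g : B) : A) = s.sup fun i => (g i : A) := by
  classical
  induction s using Finset.induction_on with
  | empty => rfl
  | insert i s _ ih => rw [Finset.sup_insert, Finset.sup_insert, ← ih]; rfl

theorem Subalg.coe_aE (B : Subalg A) (v : V → B) (T : Finset V) :
    ((aE v T : B) : A) = aE (fun i => (v i : A)) T := by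
  have : ((aE v T : B) : A) = ((T.inf v : B) : A) ⊓ ((_ : B) : A) := rfl
  rw [this, B.coe_finset_inf, B.coe_finset_inf]
  rfl

theorem Subalg.coe_pE (B : Subalg A) (v : V → B) (q : Finset V × Finset (Finset V)) :
    ((pE v q : B) : A) = pE (fun i => (v i : A)) q := by
  have : ((pE v q : B) : A) = ((q.1.inf v : B) : A) ⊓ (((q.2.sup (aE v) : B) : A))ᶜᶜ := rfl
  rw [this, B.coe_finset_inf, B.coe_finset_sup]
  simp only [B.coe_aE]
  rfl

theorem Subalg.isAt_coe_iff (B : Subalg A) (v : V → B) (t : B) :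
    IsAt (fun i => (v i : A)) (t : A) ↔ IsAt v t := by
  simp only [IsAt, ← B.coe_aE, Subtype.ext_iff, ne_eq]
  rfl

theorem Subalg.isJirr_coe_iff (B : Subalg A) (v : V → B) (t : B) :
    IsJirr (fun i => (v i : A)) (t : A) ↔ IsJirr v t := by
  simp only [IsJirr, ne_eq, Subtype.ext_iff (a1 := t), B.coe_finset_sup, B.coe_pE]

theorem Subalg.fsHolds_coe_iff (B : Subalg A) {n m h : ℕ} (hn : 0 < n) (f : Enum h)
    (v : Fin n ⊕ Fin m → B) : FSHolds hn f (fun i => (v i : A)) ↔ FSHolds hn f v := by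
  simp only [FSHolds, PHolds, QHolds, B.isJirr_coe_iff, B.isAt_coe_iff, ← B.coe_pE, Subalg.coe_inj']
  rfl

end Restriction

end PDL

namespace PDL

/-! ### The dual of a finite algebra and its free skeletons. -/

section FiniteDual

open Order

variable {B : Type*} [PDLattice B]

/-- The prime filter generated by a sup-prime element. -/
def dualOf {j : B} (hj : SupPrime j) : Dual B :=
  ⟨PFilter.principal j, ⟨by
    refine ⟨fun a b hba ha hb => ha ?_, ⟨⊥, fun h => ?_⟩, fun a ha b hb => ⟨a ⊔ b, fun h => ?_,
      le_sup_left, le_sup_right⟩⟩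
    · exact PFilter.mem_of_le hba hb
    · exact hj.ne_bot (le_bot_iff.1 (PFilter.mem_principal.1 h))
    · exact (hj.2 (PFilter.mem_principal.1 h)).elim (fun h => ha (PFilter.mem_principal.2 h))
        fun h => hb (PFilter.mem_principal.2 h)⟩⟩

/-- A finite filter is generated by the meet of its members, and primeness of the filter is
sup-primeness of that meet. -/
theorem exists_dualOf [Finite B] (F : Dual B) : ∃ (j : B) (hj : SupPrime j), dualOf hj = F := by
  classical
  obtain ⟨F, hF⟩ := F
  have := Fintype.ofFinite B
  let j : B := (Finset.univ.filter (· ∈ F)).inf id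
  have hjF : j ∈ F := by
    refine Finset.inf_induction (p := (· ∈ F)) PFilter.top_mem (fun a ha b hb => ?_) ?_
    · exact PFilter.inf_mem ha hb
    · simp
  have hle : ∀ b, b ∈ F ↔ j ≤ b := fun b =>
    ⟨fun hb => Finset.inf_le (f := id) (by simpa using hb), fun h => PFilter.mem_of_le h hjF⟩
  have hjp : SupPrime j := by
    refine ⟨fun hmin => ?_, fun b c hbc => ?_⟩
    · obtain ⟨a, ha⟩ := hF.compl_ideal.Nonempty
      exact ha ((hle a).2 (isMin_iff_eq_bot.1 hmin ▸ bot_le))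
    · by_contra! hcon
      obtain ⟨d, hd, hbd, hcd⟩ := hF.compl_ideal.Directed b (fun h => hcon.1 ((hle b).1 h))
        c (fun h => hcon.2 ((hle c).1 h))
      exact hd ((hle d).2 (hbc.trans (sup_le hbd hcd)))
  refine ⟨j, hjp, Subtype.ext (SetLike.ext fun b => ?_)⟩
  exact PFilter.mem_principal.trans (hle b).symm

theorem dualOf_le {i j : B} {hi : SupPrime i} {hj : SupPrime j} :
    dualOf hi ≤ dualOf hj ↔ j ≤ i :=
  PFilter.principal_le_principal_iff

theorem inf_eq_bot_of_isAtom {a b : B} (ha : IsAtom a) (h : ¬ a ≤ b) : a ⊓ b = ⊥ :=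
  (ha.le_iff.1 inf_le_left).resolve_right fun h' => h (inf_eq_left.1 h')

theorem supPrime_of_isAtom {a : B} (ha : IsAtom a) : SupPrime a := by
  refine ⟨fun h => ha.1 (isMin_iff_eq_bot.1 h), fun b c hbc => ?_⟩
  by_contra! hcon
  refine ha.1 ?_
  rw [← inf_eq_left, inf_sup_left, inf_eq_bot_of_isAtom ha hcon.1,
    inf_eq_bot_of_isAtom ha hcon.2] at hbc
  simpa using hbc.symm

theorem exists_supPrime_le [Finite B] {b c : B} (h : ¬ b ≤ c) :
    ∃ j, SupPrime j ∧ j ≤ b ∧ ¬ j ≤ c := by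
  obtain ⟨s, hs, hirr⟩ := exists_supIrred_decomposition b
  by_contra! hcon
  refine h (hs ▸ Finset.sup_le fun j hj => hcon j (hirr hj).supPrime ?_)
  exact hs ▸ Finset.le_sup (f := id) hj

theorem exists_isAtom_le [Finite B] {b : B} (h : b ≠ ⊥) : ∃ a, IsAtom a ∧ a ≤ b :=
  (IsAtomic.eq_bot_or_exists_atom_le b).resolve_left h

theorem maximal_dualOf_iff [Finite B] {j a : B} (hj : SupPrime j) (ha : SupPrime a) :
    dualOf ha ∈ maxAbove (dualOf hj) ↔ IsAtom a ∧ a ≤ j := by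
  constructor
  · rintro ⟨h, hmax⟩
    have haj := dualOf_le.1 h
    obtain ⟨c, hc, hca⟩ := exists_isAtom_le ha.ne_bot
    have := dualOf_le.1 (hmax (y := dualOf (supPrime_of_isAtom hc))
      (dualOf_le.2 (hca.trans haj)) (dualOf_le.2 hca))
    exact ⟨le_antisymm this hca ▸ hc, haj⟩
  · rintro ⟨hat, haj⟩
    refine ⟨dualOf_le.2 haj, fun G hG hle => ?_⟩
    obtain ⟨c, hc, rfl⟩ := exists_dualOf G
    have := dualOf_le.1 hle
    rcases hat.le_iff.1 this with h | h
    · exact absurd h hc.ne_bot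
    · exact dualOf_le.2 h.ge

/-- For the sup-prime element `x`, monotone choice of sup-prime elements below `x` with
prescribed atoms. -/
def LocalSkeleton (x : B) : Prop :=
  ∃ s : Set B → B, (∀ Y : Set B, Y.Nonempty → (∀ a ∈ Y, IsAtom a ∧ a ≤ x) →
      SupPrime (s Y) ∧ s Y ≤ x ∧ ∀ a, IsAtom a → (a ≤ s Y ↔ a ∈ Y)) ∧
    ∀ Y Z : Set B, Y.Nonempty → (∀ a ∈ Z, IsAtom a ∧ a ≤ x) → Y ⊆ Z → s Y ≤ s Z

/-- If `rᶜᶜ ≤ b ⊔ c`, then `rᶜᶜ` is the join of its meets with `b` and `c`, to which `DN` applies.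
-/
theorem DNHolds.supPrime_of_compl (hB : DNHolds B) {r : B}
    (hr : rᶜᶜ ≠ ⊥) : SupPrime rᶜᶜ := by
  refine ⟨fun h => hr (isMin_iff_eq_bot.1 h), fun b c hbc => ?_⟩
  refine (hB r (rᶜᶜ ⊓ b) (rᶜᶜ ⊓ c) ?_).imp inf_eq_left.1 inf_eq_left.1
  rw [← inf_sup_left, inf_eq_left.2 hbc]

theorem le_compl_compl_of_atoms [Finite B] {t r : B}
    (h : ∀ a, IsAtom a → a ≤ t → a ≤ rᶜᶜ) : t ≤ rᶜᶜ := by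
  rw [PDLattice.le_compl_iff]
  by_contra hne
  obtain ⟨a, ha, hat⟩ := exists_isAtom_le hne
  have h₁ := h a ha (hat.trans inf_le_left)
  refine ha.1 (le_bot_iff.1 ?_)
  exact inf_compl_eq_bot rᶜ ▸ le_inf (hat.trans inf_le_right) h₁

open Classical in
theorem isAtom_le_sup_compl_compl_iff [Fintype B] {Y : Set B} (hY : ∀ a ∈ Y, IsAtom a) {a : B}
    (ha : IsAtom a) : a ≤ (Y.toFinset.sup id)ᶜᶜ ↔ a ∈ Y := by
  constructor
  · intro h
    by_contra haY
    refine ha.1 ?_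
    have : a ≤ (Y.toFinset.sup id)ᶜ := by
      rw [PDLattice.le_compl_iff, Finset.sup_inf_distrib_left]
      refine (Finset.sup_eq_bot_iff _ _).2 fun b hb => ?_
      have hb : b ∈ Y := by simpa using hb
      refine inf_eq_bot_of_isAtom ha fun hab => haY ?_
      rwa [((hY b hb).le_iff.1 hab).resolve_left ha.1]
    exact le_bot_iff.1 (inf_compl_eq_bot (Y.toFinset.sup id)ᶜ ▸ le_inf this h)
  · intro h
    exact (Finset.le_sup (f := id) (by simpa using h)).trans (le_compl_compl_self _)

theorem hasFreeSkeleton_of_localSkeleton [Finite B] (hne : (⊥ : B) ≠ ⊤)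
    (hDN : DNHolds B)
    (hloc : ∀ x : B, SupPrime x → LocalSkeleton x) : HasFreeSkeleton (Dual B) := by
  classical
  have := Fintype.ofFinite B
  have htop : SupPrime (⊤ : B) := by
    have : (⊤ : B)ᶜᶜ = ⊤ := by rw [top_compl_eq, bot_compl_eq]
    rw [← this]
    exact DNHolds.supPrime_of_compl hDN (by rw [this]; exact hne.symm)
  choose e he hee using exists_dualOf (B := B)
  have hle : ∀ F G : Dual B, F ≤ G ↔ e G ≤ e F := fun F G => by
    conv_lhs => rw [← hee F, ← hee G]
    exact dualOf_le
  have hed : ∀ {j : B} (hj : SupPrime j), e (dualOf hj) = j := fun hj =>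
    le_antisymm (dualOf_le.1 (hee (dualOf hj)).ge) (dualOf_le.1 (hee (dualOf hj)).le)
  have hmax : ∀ F G : Dual B, G ∈ maxAbove F ↔ IsAtom (e G) ∧ e G ≤ e F := fun F G => by
    conv_lhs => rw [← hee F, ← hee G]
    exact maximal_dualOf_iff _ _
  have hlocal : ∀ x : B, SupPrime x → ∃ s : Set B → B,
      ((∀ Y : Set B, Y.Nonempty → (∀ a ∈ Y, IsAtom a ∧ a ≤ x) →
        SupPrime (s Y) ∧ s Y ≤ x ∧ ∀ a, IsAtom a → (a ≤ s Y ↔ a ∈ Y)) ∧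
      ∀ Y Z : Set B, Y.Nonempty → (∀ a ∈ Z, IsAtom a ∧ a ≤ x) → Y ⊆ Z → s Y ≤ s Z) ∧
      (x = ⊤ → ∀ Y, s Y = (Y.toFinset.sup id)ᶜᶜ) := by
    intro x hx
    -- `LocalSkeleton` says nothing about condition (iii), so at the top the given choice is
    -- replaced by the double complement of the join of `Y`.
    by_cases hxt : x = ⊤
    · refine ⟨fun Y => (Y.toFinset.sup id)ᶜᶜ, ⟨fun Y hY hYx => ⟨?_, hxt ▸ le_top, fun a ha =>
        isAtom_le_sup_compl_compl_iff (fun a ha => (hYx a ha).1) ha⟩, fun Y Z _ _ hYZ => ?_⟩,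
        fun _ _ => rfl⟩
      · refine DNHolds.supPrime_of_compl hDN fun h => ?_
        obtain ⟨a, ha⟩ := hY
        have := (isAtom_le_sup_compl_compl_iff (fun a ha => (hYx a ha).1) (hYx a ha).1).2 ha
        exact (hYx a ha).1.1 (le_bot_iff.1 (h ▸ this))
      · exact compl_le_compl_of_le (compl_le_compl_of_le
          (Finset.sup_mono (Set.toFinset_subset_toFinset.2 hYZ)))
    · obtain ⟨s, hs⟩ := hloc x hx
      exact ⟨s, hs, fun h => absurd h hxt⟩
  choose! s hs hst using hlocal
  have him : ∀ {F : Dual B} {Y : Set (Dual B)}, Y ⊆ maxAbove F →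
      ∀ a ∈ e '' Y, IsAtom a ∧ a ≤ e F := by
    rintro F Y hY _ ⟨G, hG, rfl⟩
    exact (hmax F G).1 (hY hG)
  have heinj : Function.Injective e := fun F G h =>
    le_antisymm ((hle _ _).2 h.ge) ((hle _ _).2 h.le)
  -- The value `F` is a default, never reached for nonempty `Y ⊆ maxAbove F`.
  let t : Dual B → Set (Dual B) → Dual B := fun F Y =>
    if h : SupPrime (s (e F) (e '' Y)) then dualOf h else F
  have het : ∀ F Y, Y.Nonempty → Y ⊆ maxAbove F → e (t F Y) = s (e F) (e '' Y) := by
    intro F Y hne hY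
    have h := ((hs (e F) (he F)).1 (e '' Y) (hne.image e) (him hY)).1
    simp only [t, dif_pos h, hed]
  refine ⟨dualOf htop, fun F => ?_, t, fun F Y hne hY => ?_, fun F Y Z hY hZ hYF hZF hYZ => ?_,
    fun F Y hne hY hF => ?_⟩
  · rw [← hee F]
    exact dualOf_le.2 le_top
  · obtain ⟨-, h₁, h₂⟩ := (hs (e F) (he F)).1 (e '' Y) (hne.image e) (him hY)
    rw [hle, het F Y hne hY]
    refine ⟨h₁, Set.ext fun G => ?_⟩
    rw [hmax, het F Y hne hY]
    constructor
    · intro hG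
      have hat := ((hmax F G).1 (hY hG)).1
      exact ⟨hat, (h₂ _ hat).2 ⟨G, hG, rfl⟩⟩
    · rintro ⟨hat, hG⟩
      exact heinj.mem_set_image.1 ((h₂ _ hat).1 hG)
  · rw [hle, het F Y hY hYF, het F Z hZ hZF]
    exact (hs (e F) (he F)).2 _ _ (hY.image e) (him hZF) (Set.image_mono hYZ)
  · have hY' : Y ⊆ maxAbove (dualOf htop) := fun G hG => by
      refine ⟨(hle _ _).2 ?_, fun H _ hGH => hY hG hGH⟩
      rw [hed]
      exact le_top
    rw [hle, het _ Y hne hY', hst _ (he _) (hed htop)]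
    refine le_compl_compl_of_atoms fun a ha haF => ?_
    rw [isAtom_le_sup_compl_compl_iff (fun a ha => (him hY' a ha).1) ha]
    refine ⟨dualOf (supPrime_of_isAtom ha), hF ((hmax _ _).2 ?_), hed _⟩
    rw [hed]
    exact ⟨ha, haF⟩

theorem HasFreeSkeleton.properties [Finite B] (h : HasFreeSkeleton (Dual B)) :
    (⊥ : B) ≠ ⊤ ∧ DNHolds B ∧
      ∀ x : B, SupPrime x → LocalSkeleton x := by
  classical
  obtain ⟨b, hb, s, h₁, h₂, h₃⟩ := h
  choose e he hee using exists_dualOf (B := B)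
  have hle : ∀ F G : Dual B, F ≤ G ↔ e G ≤ e F := fun F G => by
    conv_lhs => rw [← hee F, ← hee G]
    exact dualOf_le
  have hed : ∀ {j : B} (hj : SupPrime j), e (dualOf hj) = j := fun hj =>
    le_antisymm (dualOf_le.1 (hee (dualOf hj)).ge) (dualOf_le.1 (hee (dualOf hj)).le)
  have hmax : ∀ F G : Dual B, G ∈ maxAbove F ↔ IsAtom (e G) ∧ e G ≤ e F := fun F G => by
    conv_lhs => rw [← hee F, ← hee G]
    exact maximal_dualOf_iff _ _
  have hpre : ∀ {F : Dual B} {Y : Set B}, (∀ a ∈ Y, IsAtom a ∧ a ≤ e F) →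
      e ⁻¹' Y ⊆ maxAbove F := fun hY G hG => (hmax _ G).2 (hY _ hG)
  have hpn : ∀ {Y : Set B}, Y.Nonempty → (∀ a ∈ Y, IsAtom a) → (e ⁻¹' Y).Nonempty := by
    rintro Y ⟨a, ha⟩ hY
    refine ⟨dualOf (supPrime_of_isAtom (hY a ha)), ?_⟩
    simpa [hed] using ha
  have hsk : ∀ {F : Dual B} {Y : Set B}, Y.Nonempty → (∀ a ∈ Y, IsAtom a ∧ a ≤ e F) →
      e (s F (e ⁻¹' Y)) ≤ e F ∧ ∀ a, IsAtom a → (a ≤ e (s F (e ⁻¹' Y)) ↔ a ∈ Y) := by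
    intro F Y hne hY
    obtain ⟨h₄, h₅⟩ := h₁ F (e ⁻¹' Y) (hpn hne fun a ha => (hY a ha).1) (hpre hY)
    refine ⟨(hle _ _).1 h₄, fun a ha => ?_⟩
    have := Set.ext_iff.1 h₅ (dualOf (supPrime_of_isAtom ha))
    rw [hmax, Set.mem_preimage, hed] at this
    exact ⟨fun h => this.2 ⟨ha, h⟩, fun h => (this.1 h).2⟩
  refine ⟨fun hbt => (he b).ne_bot (le_bot_iff.1 (hbt ▸ le_top)), fun x y z hxyz => ?_,
    fun x hx => ?_⟩
  · by_cases hx : xᶜᶜ = ⊥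
    · exact .inl (le_antisymm (hxyz ▸ le_sup_left) (hx ▸ bot_le))
    let Y : Set B := {a | IsAtom a ∧ a ≤ xᶜᶜ}
    have hYn : Y.Nonempty := exists_isAtom_le hx
    have hbtop : e b = ⊤ := by
      by_contra hne
      obtain ⟨j, hj, -, hjb⟩ := exists_supPrime_le fun h => hne (top_le_iff.1 h)
      have := (hle _ _).1 (hb (dualOf hj))
      rw [hed] at this
      exact hjb this
    have hY : ∀ a ∈ Y, IsAtom a ∧ a ≤ e b := fun a ha => ⟨ha.1, hbtop ▸ le_top⟩
    have hst := (hsk hYn hY).2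
    -- One inequality holds because the skeleton element has exactly the atoms in `Y`; for the
    -- other, (iii) puts every sup-prime element below `xᶜᶜ` under it.
    have heq : e (s b (e ⁻¹' Y)) = xᶜᶜ := by
      refine le_antisymm (le_compl_compl_of_atoms fun a ha h => ((hst a ha).1 h).2) ?_
      by_contra hne
      obtain ⟨j, hj, hjx, hjs⟩ := exists_supPrime_le hne
      have := (hle _ _).1 (h₃ (dualOf hj) (e ⁻¹' Y) (hpn hYn fun a ha => ha.1)
        (fun G hG H hGH => (hpre hY hG).2 (hb H) hGH) fun G hG => ?_)
      · rw [hed] at this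
        exact hjs this
      · obtain ⟨hG₁, hG₂⟩ := (hmax _ _).1 hG
        rw [hed] at hG₂
        exact ⟨hG₁, hG₂.trans hjx⟩
    have hp := he (s b (e ⁻¹' Y))
    rw [heq] at hp
    refine (hp.2 hxyz.le).imp (fun h => le_antisymm (hxyz ▸ le_sup_left) h)
      fun h => le_antisymm (hxyz ▸ le_sup_right) h
  · refine ⟨fun Y => e (s (dualOf hx) (e ⁻¹' Y)), fun Y hYn hY => ?_, fun Y Z hYn hZ hYZ => ?_⟩
    · have := hsk (F := dualOf hx) hYn (by rw [hed]; exact hY)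
      rw [hed] at this
      exact ⟨he _, this⟩
    · have hZ' : ∀ a ∈ Z, IsAtom a ∧ a ≤ e (dualOf hx) := by rw [hed]; exact hZ
      rw [← hle]
      exact h₂ _ _ _ (hpn hYn fun a ha => (hZ a (hYZ ha)).1)
        (hpn (hYn.mono hYZ) fun a ha => (hZ a ha).1) (hpre fun a ha => hZ' a (hYZ ha)) (hpre hZ')
        (Set.preimage_mono hYZ)

end FiniteDual

end PDL

namespace PDL

/-! ### Local skeletons and the `FS` formulas. -/

section Correspondence

theorem localSkeleton_of_fsHolds {B : Type*} [PDLattice B] [Finite B] (f : ∀ h : ℕ, Enum h)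
    (hFS : ∀ (n m h : ℕ) (hn : 0 < n), 0 < h → h ≤ m →
      ∀ v : Fin n ⊕ Fin m → B, FSHolds hn (f h) v) {x : B} (hx : SupPrime x) :
    LocalSkeleton x := by
  classical
  obtain ⟨h, ⟨g⟩⟩ := Finite.exists_equiv_fin {a : B // IsAtom a ∧ a ≤ x}
  obtain ⟨k, ⟨e⟩⟩ := Finite.exists_equiv_fin B
  have hh : 0 < h := by
    obtain ⟨a, ha, hax⟩ := exists_isAtom_le hx.ne_bot
    exact (g ⟨a, ha, hax⟩).pos
  -- The first variable is `x`, the next `k` list all of `B` so that the tuple generates, and the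
  -- `y`'s are exactly the atoms below `x`; with `m = h` the last part of `PHolds` is vacuous.
  let v : Fin (k + 1) ⊕ Fin h → B :=
    Sum.elim (Fin.cons x e.symm) fun i => (g.symm i : B)
  have hv : Generates v := generates_of_surjective fun b => ⟨.inl (e b).succ, by simp [v]⟩
  obtain ⟨S, ⟨⟨⟨hQ₁, hQ₂⟩, hQ₃⟩, hQ₄⟩, hJ⟩ := hFS (k + 1) h h k.succ_pos hh le_rfl v ⟨⟨
    (hv.isJirr_iff _).2 ⟨hx, .inl ⟨0, k.succ_pos⟩, le_rfl⟩,
    fun i => (hv.isAt_iff _).2 (g.symm i).2.1⟩,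
    ⟨fun p hp => p.2.1.ne (g.symm.injective (Subtype.ext hp)), fun i => (g.symm i.1).2.2⟩,
    fun j => absurd j.1.2 j.2.not_gt⟩
  let idx : Set B → Finset ℕ := fun Y =>
    (Finset.univ.filter fun j : Fin h => (g.symm j : B) ∈ Y).image (↑)
  have hidx : ∀ Y (j : Fin h), (j : ℕ) ∈ idx Y ↔ (g.symm j : B) ∈ Y := fun Y j => by
    simp [idx, Fin.val_inj]
  have hidx' : ∀ Y, idx Y ⊆ Finset.range h := fun Y i hi => by
    obtain ⟨j, -, rfl⟩ := Finset.mem_image.1 hi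
    simp
  have hne : ∀ Y : Set B, Y.Nonempty → (∀ a ∈ Y, IsAtom a ∧ a ≤ x) → (idx Y).Nonempty := by
    rintro Y ⟨a, ha⟩ hY
    exact ⟨g ⟨a, hY a ha⟩, (hidx _ _).2 (by simpa using ha)⟩
  let z : Set B → B := fun Y =>
    if hY : (idx Y).Nonempty then pE v (S ((f h).symm ⟨idx Y, hidx' Y, hY⟩)).1 else x
  have hz : ∀ Y (hY : (idx Y).Nonempty),
      z Y = pE v (S ((f h).symm ⟨idx Y, hidx' Y, hY⟩)).1 := fun Y hY => dif_pos hY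
  refine ⟨z, fun Y hYn hY => ?_, fun Y Z hYn hZ hYZ => ?_⟩
  · have hi := hne Y hYn hY
    rw [hz Y hi]
    refine ⟨((hv.isJirr_iff _).1 (hJ _)).1, hQ₁ _, fun a ha => ⟨fun hle => ?_, fun haY => ?_⟩⟩
    · by_contra haY
      refine hQ₄ ⟨((f h).symm ⟨idx Y, hidx' Y, hi⟩, g ⟨a, ha, hle.trans (hQ₁ _)⟩), ?_⟩ ?_
      · simpa [hidx] using haY
      · simpa [v] using hle
    · have := hQ₃ ⟨((f h).symm ⟨idx Y, hidx' Y, hi⟩, g ⟨a, hY a haY⟩), by simpa [hidx] using haY⟩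
      simpa [v] using this
  · have hi := hne Y hYn fun a ha => hZ a (hYZ ha)
    have hj := hne Z (hYn.mono hYZ) hZ
    rw [hz Y hi, hz Z hj]
    refine hQ₂ ⟨(_, _), ?_⟩
    simp only [Equiv.apply_symm_apply]
    exact Finset.image_subset_image fun j hj => by
      simp only [Finset.mem_filter] at hj ⊢
      exact ⟨hj.1, hYZ hj.2⟩

theorem fsHolds_of_localSkeleton {B : Type*} [PDLattice B] {n m h : ℕ} (hn : 0 < n) (hm : h ≤ m)
    (f : Enum h) (hloc : ∀ x : B, SupPrime x → LocalSkeleton x) {v : Fin n ⊕ Fin m → B}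
    (hv : Generates v) : FSHolds hn f v := by
  rintro ⟨⟨hx, hy⟩, ⟨hP₁, hP₂⟩, hP₃⟩
  have hxp := ((hv.isJirr_iff _).1 hx).1
  have hat : ∀ i, IsAtom (v (.inr i)) := fun i => (hv.isAt_iff _).1 (hy i)
  obtain ⟨s, hs₁, hs₂⟩ := hloc _ hxp
  -- The witness for `z_i` is the skeleton element with atoms `y_j`, `j ∈ f i`.
  let Y : Fin (2 ^ h - 1) → Set B := fun i => {a | ∃ j : Fin m, (j : ℕ) ∈ (f i).1 ∧ v (.inr j) = a}
  have hlt : ∀ i {j : ℕ}, j ∈ (f i).1 → j < h := fun i j hj => Finset.mem_range.1 ((f i).2.1 hj)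
  have hY : ∀ i, ∀ a ∈ Y i, IsAtom a ∧ a ≤ v (.inl ⟨0, hn⟩) := by
    rintro i _ ⟨j, hj, rfl⟩
    exact ⟨hat j, hP₂ ⟨j, hlt i hj⟩⟩
  have hYn : ∀ i, (Y i).Nonempty := fun i => by
    obtain ⟨j, hj⟩ := (f i).2.2
    exact ⟨_, ⟨j, (hlt i hj).trans_le hm⟩, hj, rfl⟩
  have hz := fun i => (hs₁ (Y i) (hYn i) (hY i))
  have hzJ : ∀ i, IsJirr v (s (Y i)) := fun i => (hv.isJirr_iff _).2 ⟨(hz i).1, _, (hz i).2.1⟩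
  choose S hS _ using hzJ
  have hSeq : (fun j => pE v (S j).1) = fun j => s (Y j) := funext fun j => (hS j).symm
  refine ⟨S, ?_, fun j => ?_⟩
  · rw [hSeq]
    refine ⟨⟨⟨fun i => (hz i).2.1, fun p => hs₂ _ _ (hYn _) (hY _) ?_⟩, fun p => ?_⟩,
      fun p hle => ?_⟩
    · rintro _ ⟨j, hj, rfl⟩
      exact ⟨j, p.2 hj, rfl⟩
    · exact ((hz p.1.1).2.2 _ (hat _)).2 ⟨p.1.2, p.2, rfl⟩
    · obtain ⟨j, hj, hjeq⟩ := ((hz p.1.1).2.2 _ (hat _)).1 hle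
      have hjh := hlt _ hj
      -- Distinctness is only known for indices below `h`; a later `y` cannot lie below `z ≤ x_1`.
      have hph : (p.1.2 : ℕ) < h := by
        by_contra hge
        exact hP₃ ⟨p.1.2, not_lt.1 hge⟩ (hle.trans (hz _).2.1)
      have hneq : j ≠ p.1.2 := fun heq => p.2 (heq ▸ hj)
      rcases hneq.lt_or_gt with hlt' | hlt'
      · exact hP₁ ⟨(j, p.1.2), hlt', hph⟩ hjeq
      · exact hP₁ ⟨(p.1.2, j), hlt', hjh⟩ hjeq.symm
  · rw [← hS]
    exact (hv.isJirr_iff _).2 ⟨(hz j).1, _, (hz j).2.1⟩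

theorem generates_genSubalg {A : Type*} [PDLattice A] {V : Type} [Fintype V] (v : V → A) :
    Generates (A := genSubalg v) fun i => ⟨v i, mem_genSubalg v i⟩ := by
  rintro ⟨_, 𝒢, rfl⟩
  refine ⟨𝒢, Subtype.ext ?_⟩
  rw [Subalg.coe_finset_sup]
  simp only [Subalg.coe_pE]

end Correspondence

end PDL

theorem mainTheorem7 {A : Type*} [PDLattice A] (f : ∀ h : ℕ, PDL.Enum h) :
    FirstOrder.Language.Theory.Model A (PDL.Axioms f) ↔
      ∀ B : PDL.Subalg A, Finite B → PDL.HasFreeSkeleton (PDL.Dual B) := by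
  rw [PDL.model_axioms_iff]
  constructor
  · rintro ⟨hne, hDN, hFS⟩ B hB
    refine PDL.hasFreeSkeleton_of_localSkeleton (fun h => hne (congrArg Subtype.val h)) ?_
      fun x hx => PDL.localSkeleton_of_fsHolds f (fun n m h hn hh hm v => ?_) hx
    · intro x y z hxyz
      exact (hDN x y z (congrArg Subtype.val hxyz)).imp Subtype.ext Subtype.ext
    · exact (B.fsHolds_coe_iff hn (f h) v).1 (hFS n m h hn hh hm _)
  · intro H
    have hp := fun {V : Type} [Fintype V] (v : V → A) =>
      (H (PDL.genSubalg v) (PDL.finite_genSubalg v))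
    refine ⟨fun h => ?_, fun x y z hxyz => ?_, fun n m h hn hh hm v => ?_⟩
    -- The empty tuple suffices, as `0 ≠ 1` has no variables.
    · have := PDL.finite_genSubalg (A := A) Empty.elim
      exact (hp Empty.elim).properties.1 (Subtype.ext h)
    · have := PDL.finite_genSubalg ![x, y, z]
      have hm := PDL.mem_genSubalg ![x, y, z]
      exact ((hp ![x, y, z]).properties.2.1 ⟨x, hm 0⟩ ⟨y, hm 1⟩ ⟨z, hm 2⟩ (Subtype.ext hxyz)).imp
        (congrArg Subtype.val) (congrArg Subtype.val)
    · have := PDL.finite_genSubalg v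
      exact ((PDL.genSubalg v).fsHolds_coe_iff hn (f h) _).2
        (PDL.fsHolds_of_localSkeleton hn hm (f h) (hp v).properties.2.2
          (PDL.generates_genSubalg v))
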